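/- **Setting.** Let $\mathcal X\subseteq\mathbb R^q$, $\mathcal Y\subseteq\mathbb R$ and $\Theta\subseteq\mathbb R^d$. For $\theta\in\Theta$ and $x\in\mathcal X$ let $P_{Z\mid\theta,X=x}$ be a probability distribution on $\mathbb R$ without atoms, depending measurably on $x$, and let $g:\mathcal Y\to\mathbb R$ be a fixed monotone increasing (i.e. nondecreasing) function. Let $P_{Y\mid g,\theta,X=x}$ be the law on $\mathcal Y$ induced by the transformed regression model $g(y)=z$, $z\sim P_{Z\mid\theta,X=x}$, i.e. the probability law (depending measurably on $x$) whose image under $g$ is $P_{Z\mid\theta,X=x}$; it is assumed to exist (it is then unique). Let $p(y\mid g,\theta,x)\in[0,\infty)$, jointly measurable in $(\theta,x,y)$, be a density of this law with respect to some $\sigma$-finite measure on $\mathcal Y$ not depending on $(\theta,x)$. Let $P_0$ be an arbitrary probability measure on $\mathcal X\times\mathcal Y$ (the true data-generating process, not assumed to belong to the model), let $(x_1,y_1),(x_2,y_2),\dots$ be i.i.d. with law $P_0$, and write $\mathcal D_n=\{(x_i,y_i)\}_{i=1}^n$. Let $P_{g,\theta}$ be the law of $(X,Y)$ for which $X$ has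 the $P_0$-marginal law and $Y\mid X=x$ has law $P_{Y\mid g,\theta,X=x}$. Let $\Pi_\theta$ be a prior probability measure on $\Theta$, and let $$p(\theta\in A\mid\mathcal D_n,g)=\frac{\int_A\prod_{i=1}^n p(y_i\mid g,\theta,x_i)\,\Pi_\theta(d\theta)}{\int_\Theta\prod_{i=1}^n p(y_i\mid g,\theta,x_i)\,\Pi_\theta(d\theta)}$$ be the conditional posterior. **Theorem.** Assume that 1. there is a $\theta^*(g)\in\operatorname{int}(\Theta)$ which is the unique minimizer of $\theta\mapsto \mathrm{KL}(P_0,P_{g,\theta})\in[0,\infty]$ over $\Theta$; 2. for every $\theta\in\Theta$, $\mathbb E_{P_0}\log p(Y\mid g,\theta,X)$ exists and is finite; 3. for $P_0$-almost every $(X,Y)$, the map $\theta\mapsto\log p(Y\mid g,\theta,X)\in[-\infty,\infty)$ is concave on $\Theta$ (in particular $\Theta$ is convex); 4. $\Pi_\theta(\mathcal U)>0$ for every open (in $\Theta$) neighbourhood $\mathcal U$ of $\theta^*(g)$. Then $p(\theta\mid\mathcal D_n,g)$ is strongly consistent at $\theta^*(g)$ in the Euclidean topology: almost surely, $p(\theta\in\mathcal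 U\mid\mathcal D_n,g)\to1$ as $n\to\infty$ for every neighbourhood $\mathcal U$ of $\theta^*(g)$ in $\Theta$. -/

import Mathlib

open MeasureTheory ProbabilityTheory Filter Topology
open scoped ENNReal NNReal

/-- The response law `Q` (the conditional law of `y ∈ 𝒴` given `x`) is the one induced by the
transformed regression model `g y = z`, `z ∼ PZ x`: if `y ∼ Q x`, then `g y ∼ PZ x`. -/
def InducedBy {𝒳 : Type*} [MeasurableSpace 𝒳] {𝒴 : Set ℝ} (g : 𝒴 → ℝ)
    (PZ : Kernel 𝒳 ℝ) (Q : Kernel 𝒳 𝒴) : Prop :=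
  ∀ x, (Q x).map g = PZ x

/-- A monotone function on a set of reals is Borel measurable. -/
theorem measurable_of_monotone_subtype {𝒴 : Set ℝ} {g : 𝒴 → ℝ} (hg : Monotone g) :
    Measurable g := by
  refine measurable_of_Iic fun c => ?_
  have hS : (lowerClosure (Subtype.val '' (g ⁻¹' Set.Iic c)) : Set ℝ).OrdConnected :=
    (lowerClosure _).lower.ordConnected
  have h : g ⁻¹' Set.Iic c =
      Subtype.val ⁻¹' (lowerClosure (Subtype.val '' (g ⁻¹' Set.Iic c)) : Set ℝ) := by
    ext y
    constructor
    · intro hy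
      exact subset_lowerClosure ⟨y, hy, rfl⟩
    · rintro ⟨_, ⟨b, hb, rfl⟩, hyb⟩
      exact (hg (show y ≤ b from hyb)).trans hb
  rw [h]
  exact measurable_subtype_coe hS.measurableSet

/-- For monotone `g` and a latent model with continuous distributions, there is at most one
response law induced by the model, so that `InducedBy` determines it. -/
theorem InducedBy.unique {𝒳 : Type*} [MeasurableSpace 𝒳] {𝒴 : Set ℝ} {g : 𝒴 → ℝ}
    (hg : Monotone g) {PZ : Kernel 𝒳 ℝ} (hPZ : ∀ x z, PZ x {z} = 0)
    {Q Q' : Kernel 𝒳 𝒴} [IsMarkovKernel Q] [IsMarkovKernel Q']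
    (h : InducedBy g PZ Q) (h' : InducedBy g PZ Q') : Q = Q' := by
  have hgm := measurable_of_monotone_subtype hg
  have key : ∀ (R : Kernel 𝒳 𝒴), InducedBy g PZ R → ∀ x (s : ℝ),
      R x (Subtype.val ⁻¹' Set.Iic s) =
        PZ x (lowerClosure (g '' (Subtype.val ⁻¹' Set.Iic s)) : Set ℝ) := by
    intro R hR x s
    have hL : MeasurableSet (lowerClosure (g '' (Subtype.val ⁻¹' Set.Iic s)) : Set ℝ) :=
      ((lowerClosure _).lower.ordConnected).measurableSet
    have hpt : ∀ c, R x (g ⁻¹' {c}) = 0 := fun c => by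
      rw [← Measure.map_apply hgm (measurableSet_singleton c), hR x, hPZ]
    rw [← hR x, Measure.map_apply hgm hL]
    apply le_antisymm
    · exact measure_mono fun y hy => subset_lowerClosure ⟨y, hy, rfl⟩
    · have hnull : R x (g ⁻¹' (lowerClosure (g '' (Subtype.val ⁻¹' Set.Iic s)) : Set ℝ) \
          (Subtype.val ⁻¹' Set.Iic s)) = 0 := by
        rcases Set.eq_empty_or_nonempty
          (g ⁻¹' (lowerClosure (g '' (Subtype.val ⁻¹' Set.Iic s)) : Set ℝ) \
            (Subtype.val ⁻¹' Set.Iic s)) with he | ⟨y₀, hy₀⟩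
        · rw [he, measure_empty]
        · refine measure_mono_null (fun y hy => ?_) (hpt (g y₀))
          have aux : ∀ u v : 𝒴,
              u ∈ g ⁻¹' (lowerClosure (g '' (Subtype.val ⁻¹' Set.Iic s)) : Set ℝ) →
              v ∉ Subtype.val ⁻¹' Set.Iic s → g u ≤ g v := by
            rintro u v ⟨_, ⟨a, ha, rfl⟩, hua⟩ hv
            refine hua.trans (hg ?_)
            have h1 : (a : ℝ) ≤ s := ha
            have h2 : s < (v : ℝ) := not_le.mp hv
            exact (h1.trans h2.le : (a : ℝ) ≤ v)
          exact le_antisymm (aux y y₀ hy.1 hy₀.2) (aux y₀ y hy₀.1 hy.2)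
      rw [← measure_sdiff_add_inter _
        (measurable_subtype_coe (measurableSet_Iic (a := s)) :
          MeasurableSet (Subtype.val ⁻¹' Set.Iic s : Set 𝒴)), hnull, zero_add]
      exact measure_mono Set.inter_subset_right
  ext x : 1
  have hmap : (Q x).map Subtype.val = (Q' x).map Subtype.val := by
    refine Measure.ext_of_Iic _ _ fun s => ?_
    rw [Measure.map_apply measurable_subtype_coe measurableSet_Iic,
      Measure.map_apply measurable_subtype_coe measurableSet_Iic, key Q h, key Q' h']
  ext A hA
  obtain ⟨B, hB, rfl⟩ := hA
  rw [← Measure.map_apply measurable_subtype_coe hB, hmap,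
    Measure.map_apply measurable_subtype_coe hB]

/-- `p x y` is a conditional density, with respect to the reference measure `ν`, of the
conditional law `Q` of `y` given `x`. -/
def IsCondDensity {𝒳 𝒴 : Type*} [MeasurableSpace 𝒳] [MeasurableSpace 𝒴]
    (ν : Measure 𝒴) (Q : Kernel 𝒳 𝒴) (p : 𝒳 → 𝒴 → ℝ≥0) : Prop :=
  ∀ x, Q x = ν.withDensity fun y => (p x y : ℝ≥0∞)

/-- `𝔼_P log f` is defined and finite. Since `Real.log 0 = 0` in Mathlib whereas `log 0 = -∞`,
the positivity of `f` almost surely is listed separately. -/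
def FiniteExpectedLog {α : Type*} [MeasurableSpace α] (P : Measure α) (f : α → ℝ≥0) : Prop :=
  (∀ᵐ a ∂P, 0 < f a) ∧ Integrable (fun a => Real.log (f a)) P

/-- `θ ↦ log (f θ) ∈ [-∞, ∞)` is a concave function on the (convex) set `Θ`. -/
def ConcaveLog {E : Type*} [AddCommGroup E] [Module ℝ E] (Θ : Set E) (f : Θ → ℝ≥0) : Prop :=
  Convex ℝ Θ ∧ ∀ (θ₁ θ₂ θ : Θ) (a b : ℝ), 0 ≤ a → 0 ≤ b → a + b = 1 →
    (θ : E) = a • (θ₁ : E) + b • (θ₂ : E) →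
    (a : EReal) * ENNReal.log (f θ₁) + (b : EReal) * ENNReal.log (f θ₂) ≤ ENNReal.log (f θ)

/-- The likelihood of `θ` based on the first `n` observations `(x i, y i)`. -/
noncomputable def likelihood {T 𝒳 𝒴 : Type*} (p : T → 𝒳 → 𝒴 → ℝ≥0)
    (x : ℕ → 𝒳) (y : ℕ → 𝒴) (n : ℕ) (θ : T) : ℝ≥0∞ :=
  ∏ i ∈ Finset.range n, (p θ (x i) (y i) : ℝ≥0∞)

/-- The posterior by Bayes' formula: `A ↦ (∫_A L dπ) / (∫ L dπ)` for the prior `π` and the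
likelihood `L`. -/
noncomputable def bayesPosterior {T : Type*} [MeasurableSpace T] (prior : Measure T)
    (L : T → ℝ≥0∞) : Measure T :=
  (∫⁻ θ, L θ ∂prior)⁻¹ • prior.withDensity L

/-- A sequence of random measures on the parameter space is strongly consistent at `θ₀`: almost
surely, the mass of every neighbourhood of `θ₀` tends to one. -/
def StronglyConsistentAt {Ω T : Type*} [MeasurableSpace Ω] [MeasurableSpace T]
    [TopologicalSpace T] (μ : Measure Ω) (post : ℕ → Ω → Measure T) (θ₀ : T) : Prop :=
  ∀ᵐ ω ∂μ, ∀ U ∈ 𝓝 θ₀, Tendsto (fun n => post n ω U) atTop (𝓝 1)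

/-!
By the strong law, almost surely the likelihood at every point `θ` of a countable dense subset of
`Θ` grows at the exponential rate `ℓ θ = 𝔼_P₀ log p(Y | g, θ, X)`. Log-concavity in `θ` makes this
locally uniform on the interior: the points where the likelihood is large form a convex set, so
lower bounds at the vertices of a small simplex extend to the simplex, and upper bounds follow from
lower bounds by reflection through a point where the rate is known.

Since `KL(P₀, P_{g,θ})` differs from `-ℓ θ` by a constant, `θs` is the unique maximiser of `ℓ`. On
a small sphere around `θs` the likelihood is therefore eventually below `exp (m n)` for some
`m < ℓ θs`. The convex set `{L n ≥ exp (m n)}` contains `θs` and misses the sphere, hence lies in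
the ball: outside the ball the likelihood grows at rate at most `m`, however large `Θ` is. The
evidence grows at rate at least `ℓ θs` because the prior charges every neighbourhood of `θs`, so
the posterior mass of the complement tends to zero.
-/

section ConvexGeometry

theorem convex_setOf_eventually_mem {E ι : Type*} [AddCommGroup E] [Module ℝ E] {l : Filter ι}
    {C : ι → Set E} (hC : ∀ᶠ i in l, Convex ℝ (C i)) : Convex ℝ {x | ∀ᶠ i in l, x ∈ C i} := by
  intro x hx y hy a b ha hb hab
  filter_upwards [hC, hx, hy] with i hi hxi hyi using hi hxi hyi ha hb hab

variable {E : Type*} [NormedAddCommGroup E] [NormedSpace ℝ E]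

theorem interior_closure_eq_interior_of_convex [FiniteDimensional ℝ E] {C : Set E}
    (hC : Convex ℝ C) : interior (closure C) = interior C := by
  rcases (interior (closure C)).eq_empty_or_nonempty with hempty | hne
  · exact (interior_mono subset_closure).antisymm' (hempty ▸ Set.empty_subset _)
  · have hspan : affineSpan ℝ C = ⊤ := by
      have hclosed := (affineSpan ℝ C).closed_of_finiteDimensional
      have hle : affineSpan ℝ (closure C) ≤ affineSpan ℝ C :=
        affineSpan_le.2 (closure_minimal (subset_affineSpan ℝ C) hclosed)
      rw [← top_le_iff, ← affineSpan_eq_top_of_nonempty_interior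
        (hne.mono (interior_mono (subset_convexHull ℝ _)))]
      exact hle
    refine hC.interior_closure_eq_interior_of_nonempty_interior ?_
    rwa [← hC.convexHull_eq, interior_convexHull_nonempty_iff_affineSpan_eq_top]

/-- A simplex around `x` with vertices in the limit set turns pointwise into locally uniform
membership. -/
theorem eventually_prod_nhds_mem_of_convex [FiniteDimensional ℝ E] {ι : Type*} {l : Filter ι}
    {C : ι → Set E} {A : Set E} (hC : ∀ᶠ i in l, Convex ℝ (C i))
    (hA : ∀ a ∈ A, ∀ᶠ i in l, a ∈ C i) {x : E} (hx : x ∈ interior (closure A)) :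
    ∀ᶠ z in l ×ˢ 𝓝 x, z.2 ∈ C z.1 := by
  have hmem : {y | ∀ᶠ i in l, y ∈ C i} ∈ 𝓝 x := by
    rw [← mem_interior_iff_mem_nhds,
      ← interior_closure_eq_interior_of_convex (convex_setOf_eventually_mem hC)]
    exact interior_mono (closure_mono hA) hx
  obtain ⟨b, hxb, hb⟩ := exists_mem_interior_convexHull_affineBasis hmem
  have hvertices : ∀ᶠ i in l, ∀ j, b j ∈ C i :=
    eventually_all.2 fun j => hb (subset_convexHull ℝ _ (Set.mem_range_self j))
  filter_upwards [(hC.and hvertices).prod_mk (mem_interior_iff_mem_nhds.1 hxb)]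
    with z ⟨⟨hconv, hbz⟩, hz⟩
  exact convexHull_min (Set.range_subset_iff.2 hbz) hconv hz

theorem subset_ball_of_convex_of_disjoint_sphere {C : Set E} (hC : Convex ℝ C) {x : E}
    (hx : x ∈ C) {ε : ℝ} (hε : 0 < ε) (hdisj : Disjoint C (Metric.sphere x ε)) :
    C ⊆ Metric.ball x ε := by
  refine hC.isPreconnected.subset_left_of_subset_union (v := (Metric.closedBall x ε)ᶜ)
    Metric.isOpen_ball Metric.isClosed_closedBall.isOpen_compl ?_ ?_
    ⟨x, hx, Metric.mem_ball_self hε⟩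
  · exact (Metric.ball_subset_closedBall).disjoint_compl_right
  · intro y hy
    rcases lt_trichotomy (dist y x) ε with h | h | h
    · exact Or.inl h
    · exact (hdisj.le_bot ⟨hy, h⟩).elim
    · exact Or.inr (by simpa using h)

end ConvexGeometry

section ExpGrowth

variable {u v : ℕ → ℝ≥0∞}

theorem eventually_lt_exp_of_expGrowthSup_lt {a : EReal} (h : ExpGrowth.expGrowthSup u < a) :
    ∀ᶠ n : ℕ in atTop, u n < EReal.exp (a * n) := by
  filter_upwards [eventually_lt_of_limsup_lt h, eventually_gt_atTop 0] with n hn hn0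
  have hn0' : (0 : EReal) < n := by exact_mod_cast hn0
  rw [EReal.div_lt_iff hn0' (EReal.natCast_ne_top n)] at hn
  simpa only [ENNReal.exp_log] using EReal.exp_strictMono hn

theorem tendsto_zero_of_expGrowthSup_neg (h : ExpGrowth.expGrowthSup u < 0) :
    Tendsto u atTop (𝓝 0) := by
  obtain ⟨a, ha, ha0⟩ := EReal.lt_iff_exists_real_btwn.1 h
  have hexp : Tendsto (fun n : ℕ => EReal.exp (a * n)) atTop (𝓝 0) := by
    have hreal : Tendsto (fun n : ℕ => Real.exp (a * n)) atTop (𝓝 0) :=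
      Real.tendsto_exp_atBot.comp
        (tendsto_natCast_atTop_atTop.const_mul_atTop_of_neg (EReal.coe_neg'.1 ha0))
    simpa only [ENNReal.ofReal_zero, ← EReal.exp_coe, EReal.coe_mul, EReal.coe_natCast] using
      ENNReal.tendsto_ofReal hreal
  exact tendsto_of_tendsto_of_tendsto_of_le_of_le' tendsto_const_nhds hexp
    (Eventually.of_forall fun n => zero_le) (ExpGrowth.eventually_le_exp ha)

theorem tendsto_div_zero_of_expGrowthSup_lt_expGrowthInf
    (h : ExpGrowth.expGrowthSup u < ExpGrowth.expGrowthInf v) :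
    Tendsto (fun n => u n / v n) atTop (𝓝 0) := by
  have hu : ExpGrowth.expGrowthSup u ≠ ⊤ := h.ne_top
  have hv : ExpGrowth.expGrowthInf v ≠ ⊥ := h.ne_bot
  refine tendsto_zero_of_expGrowthSup_neg (u := u * v⁻¹) ?_
  calc ExpGrowth.expGrowthSup (u * v⁻¹)
      ≤ ExpGrowth.expGrowthSup u + ExpGrowth.expGrowthSup v⁻¹ :=
        ExpGrowth.expGrowthSup_mul_le
          (Or.inr (by rwa [ExpGrowth.expGrowthSup_inv, Ne, EReal.neg_eq_top_iff])) (Or.inl hu)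
    _ = ExpGrowth.expGrowthSup u - ExpGrowth.expGrowthInf v := by
        rw [ExpGrowth.expGrowthSup_inv, sub_eq_add_neg]
    _ < 0 := EReal.sub_lt_of_lt_add (by rwa [zero_add])

end ExpGrowth

/-- The superlevel set `{f ≥ c}` of a function `f` on `Θ`, as a set in the ambient space. -/
def superlevel {E : Type*} {Θ : Set E} (f : Θ → ℝ≥0∞) (c : ℝ≥0∞) : Set E :=
  {x | ∃ hx : x ∈ Θ, c ≤ f ⟨x, hx⟩}

theorem coe_mem_superlevel {E : Type*} {Θ : Set E} {f : Θ → ℝ≥0∞} {c : ℝ≥0∞} {θ : Θ} :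
    (θ : E) ∈ superlevel f c ↔ c ≤ f θ :=
  ⟨fun h => h.2, fun h => ⟨θ.2, h⟩⟩

theorem superlevel_anti {E : Type*} {Θ : Set E} {f : Θ → ℝ≥0∞} : Antitone (superlevel f) :=
  fun _ _ hcd _ hx => ⟨hx.1, hcd.trans hx.2⟩

section LogConcave

variable {E : Type*} [AddCommGroup E] [Module ℝ E] {Θ : Set E}

/-- `f : Θ → [0, ∞]` is log-concave on the convex set `Θ`. The inequality is stated
multiplicatively, so that `f` may vanish. -/
def LogConcaveOn (Θ : Set E) (f : Θ → ℝ≥0∞) : Prop :=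
  Convex ℝ Θ ∧ ∀ (θ₁ θ₂ θ : Θ) (a b : ℝ), 0 ≤ a → 0 ≤ b → a + b = 1 →
    (θ : E) = a • (θ₁ : E) + b • (θ₂ : E) → f θ₁ ^ a * f θ₂ ^ b ≤ f θ

theorem ConcaveLog.logConcaveOn {f : Θ → ℝ≥0} (hf : ConcaveLog Θ f) :
    LogConcaveOn Θ fun θ => (f θ : ℝ≥0∞) := by
  refine ⟨hf.1, fun θ₁ θ₂ θ a b ha hb hab h => ?_⟩
  rw [← ENNReal.log_le_log_iff, ENNReal.log_mul_add, ENNReal.log_rpow, ENNReal.log_rpow]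
  exact hf.2 θ₁ θ₂ θ a b ha hb hab h

theorem LogConcaveOn.prod {ι : Type*} (hΘ : Convex ℝ Θ) {f : ι → Θ → ℝ≥0∞} {s : Finset ι}
    (hf : ∀ i ∈ s, LogConcaveOn Θ (f i)) : LogConcaveOn Θ fun θ => ∏ i ∈ s, f i θ := by
  refine ⟨hΘ, fun θ₁ θ₂ θ a b ha hb hab h => ?_⟩
  rw [← ENNReal.prod_rpow_of_nonneg ha, ← ENNReal.prod_rpow_of_nonneg hb,
    ← Finset.prod_mul_distrib]
  exact Finset.prod_le_prod' fun i hi => (hf i hi).2 θ₁ θ₂ θ a b ha hb hab h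

theorem LogConcaveOn.smul_add_smul_mem_superlevel {f : Θ → ℝ≥0∞} (hf : LogConcaveOn Θ f)
    {x y : E} {c d : ℝ≥0∞} (hx : x ∈ superlevel f c) (hy : y ∈ superlevel f d) {a b : ℝ}
    (ha : 0 ≤ a) (hb : 0 ≤ b) (hab : a + b = 1) :
    a • x + b • y ∈ superlevel f (c ^ a * d ^ b) := by
  obtain ⟨hxΘ, hcx⟩ := hx
  obtain ⟨hyΘ, hdy⟩ := hy
  refine ⟨hf.1 hxΘ hyΘ ha hb hab, le_trans ?_ (hf.2 ⟨x, hxΘ⟩ ⟨y, hyΘ⟩ _ a b ha hb hab rfl)⟩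
  gcongr

theorem LogConcaveOn.convex_superlevel {f : Θ → ℝ≥0∞} (hf : LogConcaveOn Θ f) (c : ℝ≥0∞) :
    Convex ℝ (superlevel f c) := by
  intro x hx y hy a b ha hb hab
  simpa only [← ENNReal.rpow_add_of_nonneg a b ha hb, hab, ENNReal.rpow_one] using
    hf.smul_add_smul_mem_superlevel hx hy ha hb hab

end LogConcave

section Rate

variable {E : Type*} [NormedAddCommGroup E] [NormedSpace ℝ E] [FiniteDimensional ℝ E]
  {Θ : Set E} {L : ℕ → Θ → ℝ≥0∞} {ℓ : E → ℝ} {D : Set Θ} {x : E}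

variable (hL : ∀ n, LogConcaveOn Θ (L n)) (hℓ : ContinuousOn ℓ (interior Θ)) (hD : Dense D)
  (hinf : ∀ θ ∈ D, (ℓ θ : EReal) ≤ ExpGrowth.expGrowthInf fun n => L n θ)
include hL hℓ hD hinf

theorem eventually_prod_nhds_mem_superlevel_exp
    (hx : x ∈ interior Θ) {m : ℝ} (hm : m < ℓ x) :
    ∀ᶠ z in atTop ×ˢ 𝓝 x, z.2 ∈ superlevel (L z.1) (EReal.exp (m * z.1)) := by
  set W := interior Θ ∩ ℓ ⁻¹' Set.Ioi m
  have hW : IsOpen W := hℓ.isOpen_inter_preimage isOpen_interior isOpen_Ioi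
  have hWD : W ⊆ closure (W ∩ (↑) '' D) := fun y hy =>
    hW.inter_closure ⟨hy, Subtype.dense_iff.1 hD (interior_subset hy.1)⟩
  have hmem : ∀ a ∈ W ∩ (↑) '' D, ∀ᶠ n : ℕ in atTop,
      a ∈ superlevel (L n) (EReal.exp (m * n)) := by
    rintro _ ⟨⟨-, hmθ⟩, θ, hθ, rfl⟩
    filter_upwards [ExpGrowth.eventually_exp_le
      ((EReal.coe_lt_coe_iff.2 hmθ).trans_le (hinf θ hθ))] with n hn
    exact coe_mem_superlevel.2 hn
  exact eventually_prod_nhds_mem_of_convex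
    (Eventually.of_forall fun n => (hL n).convex_superlevel _) hmem
    (interior_maximal hWD hW ⟨hx, hm⟩)

variable (hsup : ∀ θ ∈ D, ExpGrowth.expGrowthSup (fun n => L n θ) ≤ ℓ θ)
include hsup

/-- A large value at `θ` and the lower bound at the reflection of `θ` through a nearby point `s`
of `D` would force a large value at `s`. -/
theorem eventually_prod_nhds_notMem_superlevel_exp
    (hx : x ∈ interior Θ) {m : ℝ} (hm : ℓ x < m) :
    ∀ᶠ z in atTop ×ˢ 𝓝 x, z.2 ∉ superlevel (L z.1) (EReal.exp (m * z.1)) := by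
  obtain ⟨k, hk, hkx⟩ := exists_between (show 2 * ℓ x - m < ℓ x by linarith)
  obtain ⟨N, hN, U, hU, hlow⟩ := eventually_prod_iff.1
    (eventually_prod_nhds_mem_superlevel_exp hL hℓ hD hinf hx hkx)
  have hreflect : Tendsto (fun z : E × E => (2 : ℝ) • z.1 - z.2) (𝓝 x ×ˢ 𝓝 x) (𝓝 x) := by
    rw [← nhds_prod_eq]
    exact Continuous.tendsto' (by fun_prop) _ _ (by simp only; module)
  obtain ⟨S, hS, V, hV, hSV⟩ := eventually_prod_iff.1 (hreflect.eventually hU)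
  have hℓx : ∀ᶠ s in 𝓝 x, ℓ s < (m + k) / 2 :=
    (hℓ.continuousAt (isOpen_interior.mem_nhds hx)).eventually_lt_const (by linarith)
  obtain ⟨_, ⟨s, hsD, rfl⟩, hsS, hℓs⟩ := ((mem_closure_iff_frequently.1
    (Subtype.dense_iff.1 hD (interior_subset hx))).and_eventually (hS.and hℓx)).exists
  have hs := eventually_lt_exp_of_expGrowthSup_lt
    ((hsup s hsD).trans_lt (EReal.coe_lt_coe_iff.2 hℓs))
  filter_upwards [(hN.and hs).prod_mk hV] with ⟨n, θ⟩ ⟨⟨hn, hsn⟩, hθ⟩ hθm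
  have hmid := (hL n).smul_add_smul_mem_superlevel hθm (hlow hn (hSV hsS hθ))
    (a := 2⁻¹) (b := 2⁻¹) (by norm_num) (by norm_num) (by norm_num)
  rw [show (2⁻¹ : ℝ) • θ + (2⁻¹ : ℝ) • ((2 : ℝ) • (s : E) - θ) = s by module,
    coe_mem_superlevel, ← EReal.exp_mul, ← EReal.exp_mul, ← EReal.exp_add] at hmid
  refine (hmid.trans_lt hsn).ne (congrArg EReal.exp ?_)
  norm_cast
  ring

theorem exists_eventually_superlevel_exp_subset_of_isMax
    (hx : x ∈ interior Θ) (hmax : ∀ y ∈ interior Θ, y ≠ x → ℓ y < ℓ x) {U : Set E} (hU : U ∈ 𝓝 x) :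
    ∃ m : ℝ, m < ℓ x ∧ ∀ᶠ n : ℕ in atTop, superlevel (L n) (EReal.exp (m * n)) ⊆ U := by
  obtain ⟨ε, hε, hball⟩ := Metric.nhds_basis_closedBall.mem_iff.1
    (inter_mem hU (isOpen_interior.mem_nhds hx))
  have hsphere : Metric.sphere x ε ⊆ interior Θ := fun y hy =>
    (hball (Metric.sphere_subset_closedBall hy)).2
  obtain ⟨k, hk, hk_le⟩ := (isCompact_sphere x ε).exists_forall_le' (hℓ.mono hsphere).neg
    fun y hy => neg_lt_neg (hmax y (hsphere hy) (Metric.ne_of_mem_sphere hy hε.ne'))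
  obtain ⟨m, hkm, hm⟩ := exists_between (neg_lt.1 hk)
  have hmiss : ∀ᶠ z in atTop ×ˢ 𝓝ˢ (Metric.sphere x ε),
      z.2 ∉ superlevel (L z.1) (EReal.exp (m * z.1)) :=
    (isCompact_sphere x ε).mem_prod_nhdsSet_of_forall fun y hy =>
      eventually_prod_nhds_notMem_superlevel_exp hL hℓ hD hinf hsup (hsphere hy)
        ((le_neg.1 (hk_le y hy)).trans_lt hkm)
  refine ⟨m, hm, ?_⟩
  filter_upwards [hmiss.curry, (eventually_prod_nhds_mem_superlevel_exp hL hℓ hD hinf hx hm).curry]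
    with n hn hxn
  have hdisj : Disjoint (superlevel (L n) (EReal.exp (m * n))) (Metric.sphere x ε) :=
    Set.disjoint_right.2 fun y hy => hn.self_of_nhdsSet y hy
  exact (subset_ball_of_convex_of_disjoint_sphere ((hL n).convex_superlevel _)
    hxn.self_of_nhds hε hdisj).trans
      fun y hy => (hball (Metric.ball_subset_closedBall hy)).1

theorem exists_eventually_superlevel_exp_eq_empty
    (hx : x ∈ interior Θ) (hmax : ∀ y ∈ interior Θ, y ≠ x → ℓ y < ℓ x) :
    ∃ M : ℝ, ∀ᶠ n : ℕ in atTop, superlevel (L n) (EReal.exp (M * n)) = ∅ := by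
  obtain ⟨N, hN, U, hU, hlarge⟩ := eventually_prod_iff.1
    (eventually_prod_nhds_notMem_superlevel_exp hL hℓ hD hinf hsup hx (lt_add_one (ℓ x)))
  obtain ⟨m, hm, hsub⟩ := exists_eventually_superlevel_exp_subset_of_isMax hL hℓ hD hinf hsup hx
    hmax hU
  refine ⟨ℓ x + 1, ?_⟩
  filter_upwards [hN, hsub] with n hn hsubn
  refine Set.eq_empty_of_forall_notMem fun y hy => hlarge hn (hsubn ?_) hy
  refine superlevel_anti (EReal.exp_monotone ?_) hy
  gcongr
  exact_mod_cast (hm.trans (lt_add_one _)).le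

end Rate

section Posterior

variable {T : Type*} [MeasurableSpace T] {prior : Measure T} {L : T → ℝ≥0∞} {s : Set T}

theorem le_expGrowthInf_lintegral {L : ℕ → T → ℝ≥0∞} (hs : MeasurableSet s) (hs0 : prior s ≠ 0)
    {m : EReal} (h : ∀ᶠ n : ℕ in atTop, ∀ θ ∈ s, EReal.exp (m * n) ≤ L n θ) :
    m ≤ ExpGrowth.expGrowthInf fun n => ∫⁻ θ, L n θ ∂prior := by
  rw [← ExpGrowth.expGrowthInf_exp (a := m)]
  refine ExpGrowth.expGrowthInf_of_eventually_ge hs0 ?_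
  filter_upwards [h] with n hn
  rw [mul_comm, ← setLIntegral_const]
  exact (setLIntegral_mono' hs hn).trans (setLIntegral_le_lintegral _ _)

theorem expGrowthSup_setLIntegral_le [IsFiniteMeasure prior] {L : ℕ → T → ℝ≥0∞}
    (hs : MeasurableSet s) {m : EReal}
    (h : ∀ᶠ n : ℕ in atTop, ∀ θ ∈ s, L n θ ≤ EReal.exp (m * n)) :
    ExpGrowth.expGrowthSup (fun n => ∫⁻ θ in s, L n θ ∂prior) ≤ m := by
  rw [← ExpGrowth.expGrowthSup_exp (a := m)]
  refine ExpGrowth.expGrowthSup_le_of_eventually_le (measure_ne_top prior s) ?_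
  filter_upwards [h] with n hn
  rw [mul_comm, ← setLIntegral_const]
  exact setLIntegral_mono' hs hn

theorem bayesPosterior_apply (hs : MeasurableSet s) :
    bayesPosterior prior L s = (∫⁻ θ in s, L θ ∂prior) / ∫⁻ θ, L θ ∂prior := by
  rw [bayesPosterior, Measure.smul_apply, withDensity_apply _ hs, smul_eq_mul, mul_comm,
    div_eq_mul_inv]

theorem bayesPosterior_le_one : bayesPosterior prior L s ≤ 1 := by
  refine (measure_mono (Set.subset_univ s)).trans ?_
  rw [bayesPosterior_apply MeasurableSet.univ, setLIntegral_univ]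
  exact ENNReal.div_self_le_one

theorem isProbabilityMeasure_bayesPosterior (h0 : ∫⁻ θ, L θ ∂prior ≠ 0)
    (htop : ∫⁻ θ, L θ ∂prior ≠ ∞) : IsProbabilityMeasure (bayesPosterior prior L) := by
  constructor
  rw [bayesPosterior_apply MeasurableSet.univ, setLIntegral_univ, ENNReal.div_self h0 htop]

theorem tendsto_bayesPosterior_of_expGrowth_lt {L : ℕ → T → ℝ≥0∞} (hs : MeasurableSet s)
    (hlt : ExpGrowth.expGrowthSup (fun n => ∫⁻ θ in sᶜ, L n θ ∂prior) <
      ExpGrowth.expGrowthInf fun n => ∫⁻ θ, L n θ ∂prior)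
    (htop : ∀ᶠ n in atTop, ∫⁻ θ, L n θ ∂prior ≠ ∞) :
    Tendsto (fun n => bayesPosterior prior (L n) s) atTop (𝓝 1) := by
  have h0 : ∀ᶠ n in atTop, ∫⁻ θ, L n θ ∂prior ≠ 0 := by
    obtain ⟨a, -, ha⟩ := EReal.lt_iff_exists_real_btwn.1 hlt
    filter_upwards [ExpGrowth.eventually_exp_le ha] with n hn
    refine (lt_of_lt_of_le ?_ hn).ne'
    rw [pos_iff_ne_zero, Ne, EReal.exp_eq_zero_iff]
    exact_mod_cast EReal.coe_ne_bot (a * n)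
  have hlim := ENNReal.Tendsto.sub (tendsto_const_nhds (x := (1 : ℝ≥0∞)))
    (tendsto_div_zero_of_expGrowthSup_lt_expGrowthInf hlt) (Or.inl ENNReal.one_ne_top)
  rw [tsub_zero] at hlim
  refine hlim.congr' ?_
  filter_upwards [h0, htop] with n hn0 hntop
  have := isProbabilityMeasure_bayesPosterior hn0 hntop
  rw [← bayesPosterior_apply hs.compl, prob_compl_eq_one_sub hs,
    ENNReal.sub_sub_cancel ENNReal.one_ne_top prob_le_one]

end Posterior

section Concentration

variable {E : Type*} [NormedAddCommGroup E] [NormedSpace ℝ E] [FiniteDimensional ℝ E]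
  [MeasurableSpace E] {Θ : Set E} {L : ℕ → Θ → ℝ≥0∞} {ℓ : E → ℝ} {D : Set Θ}
  {prior : Measure Θ} {θs : Θ}

variable (hL : ∀ n, LogConcaveOn Θ (L n)) (hℓ : ContinuousOn ℓ (interior Θ)) (hD : Dense D)
  (hinf : ∀ θ ∈ D, (ℓ θ : EReal) ≤ ExpGrowth.expGrowthInf fun n => L n θ)
include hL hℓ hD hinf

theorem le_expGrowthInf_lintegral_of_mem_support [BorelSpace E]
    (hθs : (θs : E) ∈ interior Θ) (hprior : θs ∈ prior.support) :
    (ℓ θs : EReal) ≤ ExpGrowth.expGrowthInf fun n => ∫⁻ θ, L n θ ∂prior := by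
  refine EReal.ge_of_forall_gt_iff_ge.1 fun m hm => ?_
  obtain ⟨N, hN, U, hU, hlow⟩ := eventually_prod_iff.1
    (eventually_prod_nhds_mem_superlevel_exp hL hℓ hD hinf hθs (EReal.coe_lt_coe_iff.1 hm))
  obtain ⟨V, hVU, hV, hθsV⟩ := mem_nhds_iff.1 (continuous_subtype_val.continuousAt.eventually hU)
  have hV0 : prior V ≠ 0 := ((Measure.mem_support_iff_forall _).1 hprior V (hV.mem_nhds hθsV)).ne'
  refine le_expGrowthInf_lintegral hV.measurableSet hV0 ?_
  filter_upwards [hN] with n hn θ hθ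
  exact coe_mem_superlevel.1 (hlow hn (hVU hθ))

variable (hsup : ∀ θ ∈ D, ExpGrowth.expGrowthSup (fun n => L n θ) ≤ ℓ θ)
include hsup

theorem expGrowthSup_setLIntegral_compl_lt [IsFiniteMeasure prior]
    (hθs : (θs : E) ∈ interior Θ) (hmax : ∀ y ∈ interior Θ, y ≠ θs → ℓ y < ℓ θs)
    {s : Set Θ} (hs : MeasurableSet s) (hsθs : s ∈ 𝓝 θs) :
    ExpGrowth.expGrowthSup (fun n => ∫⁻ θ in sᶜ, L n θ ∂prior) < ℓ θs := by
  obtain ⟨V, hV, hVs⟩ := (mem_nhds_subtype Θ θs s).1 hsθs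
  obtain ⟨m, hm, hsub⟩ := exists_eventually_superlevel_exp_subset_of_isMax hL hℓ hD hinf hsup hθs
    hmax hV
  refine (expGrowthSup_setLIntegral_le hs.compl ?_).trans_lt (EReal.coe_lt_coe_iff.2 hm)
  filter_upwards [hsub] with n hn θ hθ
  by_contra! hlarge
  exact hθ (hVs (hn (coe_mem_superlevel.2 hlarge.le)))

theorem eventually_lintegral_ne_top [IsFiniteMeasure prior]
    (hθs : (θs : E) ∈ interior Θ) (hmax : ∀ y ∈ interior Θ, y ≠ θs → ℓ y < ℓ θs) :
    ∀ᶠ n in atTop, ∫⁻ θ, L n θ ∂prior ≠ ∞ := by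
  obtain ⟨M, hM⟩ := exists_eventually_superlevel_exp_eq_empty hL hℓ hD hinf hsup hθs hmax
  filter_upwards [hM] with n hn
  refine (IsFiniteMeasure.lintegral_lt_top_of_bounded_to_ennreal prior
    ⟨(Real.exp (M * n)).toNNReal, fun θ => ?_⟩).ne
  by_contra! hlarge
  have hmem : (θ : E) ∈ superlevel (L n) (EReal.exp (M * n)) :=
    coe_mem_superlevel.2 (by
      rw [← EReal.coe_natCast, ← EReal.coe_mul, EReal.exp_coe]
      exact hlarge.le)
  exact Set.notMem_empty _ (hn ▸ hmem)

theorem tendsto_bayesPosterior_of_logConcaveOn [BorelSpace E] [IsFiniteMeasure prior]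
    (hθs : (θs : E) ∈ interior Θ) (hmax : ∀ y ∈ interior Θ, y ≠ θs → ℓ y < ℓ θs)
    (hprior : θs ∈ prior.support) {U : Set Θ} (hU : U ∈ 𝓝 θs) :
    Tendsto (fun n => bayesPosterior prior (L n) U) atTop (𝓝 1) := by
  obtain ⟨V, hVU, hV, hθsV⟩ := mem_nhds_iff.1 hU
  have hlt := (expGrowthSup_setLIntegral_compl_lt (prior := prior) hL hℓ hD hinf hsup hθs hmax
    hV.measurableSet (hV.mem_nhds hθsV)).trans_le
      (le_expGrowthInf_lintegral_of_mem_support hL hℓ hD hinf hθs hprior)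
  have hfinite := eventually_lintegral_ne_top (prior := prior) hL hℓ hD hinf hsup hθs hmax
  exact tendsto_of_tendsto_of_tendsto_of_le_of_le
    (tendsto_bayesPosterior_of_expGrowth_lt hV.measurableSet hlt hfinite) tendsto_const_nhds
    (fun n => measure_mono hVU) fun n => bayesPosterior_le_one

end Concentration

section KullbackLeibler

variable {α : Type*} [MeasurableSpace α] {μ ν : Measure α}

theorem absolutelyContinuous_withDensity_of_ae_pos {f : α → ℝ≥0} (hμν : μ ≪ ν)
    (hf : Measurable f) (hpos : ∀ᵐ a ∂μ, 0 < f a) : μ ≪ ν.withDensity fun a => (f a : ℝ≥0∞) := by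
  refine Measure.AbsolutelyContinuous.mk fun s _ hs => ?_
  rw [withDensity_apply_eq_zero hf.coe_nnreal_ennreal] at hs
  refine measure_mono_null_ae ?_ (hμν hs)
  filter_upwards [hpos] with a ha has
  exact ⟨ENNReal.coe_ne_zero.2 ha.ne', has⟩

theorem llr_withDensity_right_ae_eq [SigmaFinite μ] [SigmaFinite ν] {f : α → ℝ≥0} (hμν : μ ≪ ν)
    (hf : Measurable f) (hpos : ∀ᵐ a ∂μ, 0 < f a) :
    llr μ (ν.withDensity fun a => (f a : ℝ≥0∞)) =ᵐ[μ] fun a => llr μ ν a - Real.log (f a) := by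
  have hac := absolutelyContinuous_withDensity_of_ae_pos hμν hf hpos
  filter_upwards [hμν.ae_le (Measure.rnDeriv_mul_rnDeriv hac),
    hμν.ae_le (Measure.rnDeriv_withDensity ν hf.coe_nnreal_ennreal), hpos,
    Measure.rnDeriv_pos hac, hac.ae_le (Measure.rnDeriv_lt_top μ _)] with a hchain hdens ha h0 htop
  simp only [llr_def]
  rw [← hchain, Pi.mul_apply, hdens, ENNReal.toReal_mul, ENNReal.coe_toReal,
    Real.log_mul (ENNReal.toReal_pos h0.ne' htop.ne).ne' (NNReal.coe_pos.2 ha).ne',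
    add_sub_cancel_right]

theorem integral_log_lt_of_klDiv_lt [IsProbabilityMeasure μ] [SigmaFinite ν] {f₁ f₂ : α → ℝ≥0}
    (hf₁ : Measurable f₁) (hf₂ : Measurable f₂)
    [IsProbabilityMeasure (ν.withDensity fun a => (f₁ a : ℝ≥0∞))]
    [IsProbabilityMeasure (ν.withDensity fun a => (f₂ a : ℝ≥0∞))]
    (h₁ : FiniteExpectedLog μ f₁) (h₂ : FiniteExpectedLog μ f₂)
    (h : InformationTheory.klDiv μ (ν.withDensity fun a => (f₁ a : ℝ≥0∞)) <
      InformationTheory.klDiv μ (ν.withDensity fun a => (f₂ a : ℝ≥0∞))) :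
    ∫ a, Real.log (f₂ a) ∂μ < ∫ a, Real.log (f₁ a) ∂μ := by
  obtain ⟨hac₁, hint₁⟩ := InformationTheory.klDiv_ne_top_iff.1 h.ne_top
  have hμν : μ ≪ ν := hac₁.trans (withDensity_absolutelyContinuous _ _)
  have hac₂ := absolutelyContinuous_withDensity_of_ae_pos hμν hf₂ h₂.1
  have hllr₁ := llr_withDensity_right_ae_eq hμν hf₁ h₁.1
  have hllr₂ := llr_withDensity_right_ae_eq hμν hf₂ h₂.1
  have hint : Integrable (llr μ ν) μ :=
    (((integrable_congr hllr₁).1 hint₁).add h₁.2).congr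
      (ae_of_all _ fun a => sub_add_cancel _ _)
  have hint₂ := (integrable_congr hllr₂).2 (hint.sub h₂.2)
  have hlt := (ENNReal.toReal_lt_toReal h.ne_top (InformationTheory.klDiv_ne_top hac₂ hint₂)).2 h
  rw [InformationTheory.toReal_klDiv_of_measure_eq hac₁ (by simp only [measure_univ]),
    InformationTheory.toReal_klDiv_of_measure_eq hac₂ (by simp only [measure_univ]),
    integral_congr_ae hllr₁, integral_congr_ae hllr₂, integral_sub hint h₁.2,
    integral_sub hint h₂.2] at hlt
  exact (sub_lt_sub_iff_left _).1 hlt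

theorem IsCondDensity.compProd_eq {𝒳 𝒴 : Type*} [MeasurableSpace 𝒳] [MeasurableSpace 𝒴]
    {ν : Measure 𝒴} [SFinite ν] {Q : Kernel 𝒳 𝒴} [IsSFiniteKernel Q] {p : 𝒳 → 𝒴 → ℝ≥0}
    (hp : IsCondDensity ν Q p) (hpm : Measurable fun xy : 𝒳 × 𝒴 => p xy.1 xy.2)
    (m : Measure 𝒳) [SFinite m] :
    m ⊗ₘ Q = (m.prod ν).withDensity fun xy => (p xy.1 xy.2 : ℝ≥0∞) := by
  ext s hs
  rw [Measure.compProd_apply hs, withDensity_apply _ hs, ← lintegral_indicator hs,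
    lintegral_prod _ (hpm.coe_nnreal_ennreal.indicator hs).aemeasurable]
  refine lintegral_congr fun x => ?_
  rw [hp x, withDensity_apply _ (measurable_prodMk_left hs),
    ← lintegral_indicator (measurable_prodMk_left hs)]
  rfl

end KullbackLeibler

section ExpectedLog

theorem log_coe_eq_coe_log {u : ℝ≥0} (hu : 0 < u) :
    ENNReal.log (u : ℝ≥0∞) = (Real.log u : EReal) := by
  rw [ENNReal.log_pos_real (ENNReal.coe_ne_zero.2 hu.ne') ENNReal.coe_ne_top, ENNReal.coe_toReal]

theorem log_prod_coe_eq_coe_sum_log {ι : Type*} {s : Finset ι} {f : ι → ℝ≥0}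
    (hf : ∀ i ∈ s, 0 < f i) :
    ENNReal.log (∏ i ∈ s, (f i : ℝ≥0∞)) = (∑ i ∈ s, Real.log (f i) : ℝ) := by
  rw [← ENNReal.ofNNReal_finsetProd, log_coe_eq_coe_log (Finset.prod_pos hf), NNReal.coe_prod,
    Real.log_prod fun i hi => (NNReal.coe_pos.2 (hf i hi)).ne']

theorem ae_tendsto_log_prod_div {Ω α : Type*} [MeasurableSpace Ω] [MeasurableSpace α]
    {μ : Measure Ω} {P : Measure α} {Z : ℕ → Ω → α} (hlaw : ∀ i, HasLaw (Z i) P μ)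
    (hindep : Pairwise fun i j => IndepFun (Z i) (Z j) μ) {f : α → ℝ≥0} (hf : Measurable f)
    (hfin : FiniteExpectedLog P f) :
    ∀ᵐ ω ∂μ, Tendsto (fun n : ℕ => ENNReal.log (∏ i ∈ Finset.range n, (f (Z i ω) : ℝ≥0∞)) / n)
      atTop (𝓝 (∫ a, Real.log (f a) ∂P : ℝ)) := by
  have hlog : Measurable fun a => Real.log (f a) := Real.measurable_log.comp hf.coe_nnreal_real
  have hint : Integrable (fun ω => Real.log (f (Z 0 ω))) μ :=
    ((hlaw 0).map_eq.symm ▸ hfin.2).comp_aemeasurable (hlaw 0).aemeasurable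
  have hslln := strong_law_ae_real (fun i ω => Real.log (f (Z i ω))) hint
    (fun i j hij => (hindep hij).comp hlog hlog)
    fun i => ((hlaw i).identDistrib (hlaw 0)).comp hlog
  have hmean : ∫ ω, Real.log (f (Z 0 ω)) ∂μ = ∫ a, Real.log (f a) ∂P :=
    (hlaw 0).integral_comp hlog.aestronglyMeasurable
  have hpos : ∀ᵐ ω ∂μ, ∀ i, 0 < f (Z i ω) := ae_all_iff.2 fun i =>
    ae_of_ae_map (hlaw i).aemeasurable ((hlaw i).map_eq.symm ▸ hfin.1)
  rw [hmean] at hslln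
  filter_upwards [hslln, hpos] with ω hlim hω
  refine (continuous_coe_real_ereal.continuousAt.tendsto.comp hlim).congr fun n => ?_
  rw [log_prod_coe_eq_coe_sum_log fun i _ => hω i, Function.comp_apply, EReal.coe_div,
    EReal.coe_natCast]

variable {E α : Type*} [MeasurableSpace α] {P : Measure α} {Θ : Set E} {f : Θ → α → ℝ≥0}

/-- The expected logarithm `θ ↦ 𝔼_P log (f θ)`, extended by zero outside `Θ` to a function on the
ambient space, as required by `ConcaveOn`. -/
noncomputable def expectedLog (P : Measure α) (f : Θ → α → ℝ≥0) : E → ℝ :=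
  Function.extend (↑) (fun θ => ∫ a, Real.log (f θ a) ∂P) 0

theorem expectedLog_coe (P : Measure α) (f : Θ → α → ℝ≥0) (θ : Θ) :
    expectedLog P f θ = ∫ a, Real.log (f θ a) ∂P :=
  Subtype.val_injective.extend_apply _ _ θ

theorem concaveOn_expectedLog [AddCommGroup E] [Module ℝ E] [NeZero P]
    (hfin : ∀ θ, FiniteExpectedLog P (f θ)) (hconc : ∀ᵐ a ∂P, ConcaveLog Θ fun θ => f θ a) :
    ConcaveOn ℝ Θ (expectedLog P f) := by
  obtain ⟨_, hΘ, -⟩ := hconc.exists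
  refine ⟨hΘ, fun x hx y hy a b ha hb hab => ?_⟩
  have hz := hΘ hx hy ha hb hab
  have hxint : Integrable (fun t => a • Real.log (f ⟨x, hx⟩ t)) P := (hfin _).2.smul a
  have hyint : Integrable (fun t => b • Real.log (f ⟨y, hy⟩ t)) P := (hfin _).2.smul b
  rw [expectedLog_coe P f ⟨x, hx⟩, expectedLog_coe P f ⟨y, hy⟩, expectedLog_coe P f ⟨_, hz⟩,
    ← integral_smul, ← integral_smul, ← integral_add hxint hyint]
  refine integral_mono_ae (hxint.add hyint) (hfin _).2 ?_
  filter_upwards [hconc, (hfin ⟨x, hx⟩).1, (hfin ⟨y, hy⟩).1, (hfin ⟨_, hz⟩).1] with t ht hxt hyt hzt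
  have hle := ht.2 ⟨x, hx⟩ ⟨y, hy⟩ ⟨_, hz⟩ a b ha hb hab rfl
  rw [log_coe_eq_coe_log hxt, log_coe_eq_coe_log hyt, log_coe_eq_coe_log hzt] at hle
  exact_mod_cast hle

theorem expectedLog_lt_of_klDiv_compProd_lt {𝒳 𝒴 : Type*} [MeasurableSpace 𝒳] [MeasurableSpace 𝒴]
    {Q : Θ → Kernel 𝒳 𝒴} [∀ θ, IsMarkovKernel (Q θ)] {ν : Measure 𝒴} [SigmaFinite ν]
    {p : Θ → 𝒳 → 𝒴 → ℝ≥0} (hpm : ∀ θ, Measurable fun xy : 𝒳 × 𝒴 => p θ xy.1 xy.2)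
    (hp : ∀ θ, IsCondDensity ν (Q θ) (p θ)) {P : Measure (𝒳 × 𝒴)} [IsProbabilityMeasure P]
    (hfin : ∀ θ, FiniteExpectedLog P fun xy => p θ xy.1 xy.2) {θ₁ θ₂ : Θ}
    (h : InformationTheory.klDiv P (P.fst ⊗ₘ Q θ₁) < InformationTheory.klDiv P (P.fst ⊗ₘ Q θ₂)) :
    expectedLog P (fun θ xy => p θ xy.1 xy.2) θ₂ <
      expectedLog P (fun θ xy => p θ xy.1 xy.2) θ₁ := by
  have hdens := fun θ => (hp θ).compProd_eq (hpm θ) P.fst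
  have hprob : ∀ θ, IsProbabilityMeasure
      ((P.fst.prod ν).withDensity fun xy => (p θ xy.1 xy.2 : ℝ≥0∞)) :=
    fun θ => hdens θ ▸ inferInstance
  have := hprob θ₁
  have := hprob θ₂
  rw [hdens, hdens] at h
  rw [expectedLog_coe, expectedLog_coe]
  exact integral_log_lt_of_klDiv_lt (hpm _) (hpm _) (hfin _) (hfin _) h

end ExpectedLog

theorem mainTheorem2_general {E 𝒳 𝒴 Ω : Type*} [NormedAddCommGroup E] [NormedSpace ℝ E]
    [FiniteDimensional ℝ E] [MeasurableSpace E] [BorelSpace E] [MeasurableSpace 𝒳]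
    [MeasurableSpace 𝒴] [MeasurableSpace Ω] (Θ : Set E)
    (Q : Θ → Kernel 𝒳 𝒴) [∀ θ, IsMarkovKernel (Q θ)]
    (ν : Measure 𝒴) [SigmaFinite ν] (p : Θ → 𝒳 → 𝒴 → ℝ≥0)
    (hp_meas : Measurable fun t : Θ × 𝒳 × 𝒴 => p t.1 t.2.1 t.2.2)
    (hp : ∀ θ, IsCondDensity ν (Q θ) (p θ))
    (prior : Measure Θ) [IsFiniteMeasure prior]
    (P₀ : Measure (𝒳 × 𝒴)) [IsProbabilityMeasure P₀] (μ : Measure Ω)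
    (X : ℕ → Ω → 𝒳) (Y : ℕ → Ω → 𝒴)
    (hlaw : ∀ i, HasLaw (fun ω => (X i ω, Y i ω)) P₀ μ)
    (hindep : Pairwise fun i j =>
      IndepFun (fun ω => (X i ω, Y i ω)) (fun ω => (X j ω, Y j ω)) μ)
    (θs : Θ) (hθs_int : (θs : E) ∈ interior Θ)
    (hθs_min : ∀ θ : Θ, θ ≠ θs →
      InformationTheory.klDiv P₀ (P₀.fst ⊗ₘ Q θs) < InformationTheory.klDiv P₀ (P₀.fst ⊗ₘ Q θ))
    (hfin : ∀ θ, FiniteExpectedLog P₀ fun xy => p θ xy.1 xy.2)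
    (hconc : ∀ᵐ xy ∂P₀, ConcaveLog Θ fun θ => p θ xy.1 xy.2)
    (hprior : θs ∈ prior.support) :
    StronglyConsistentAt μ
      (fun n ω => bayesPosterior prior (likelihood p (fun i => X i ω) (fun i => Y i ω) n)) θs := by
  have := FiniteDimensional.proper ℝ E
  have hpm : ∀ θ, Measurable fun xy : 𝒳 × 𝒴 => p θ xy.1 xy.2 := fun θ =>
    hp_meas.comp measurable_prodMk_left
  set ℓ := expectedLog P₀ fun θ xy => p θ xy.1 xy.2
  have hℓ : ConcaveOn ℝ Θ ℓ := concaveOn_expectedLog hfin hconc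
  have hmax : ∀ y ∈ interior Θ, y ≠ θs → ℓ y < ℓ θs := fun y hy hne =>
    expectedLog_lt_of_klDiv_compProd_lt hpm hp hfin
      (θ₂ := ⟨y, interior_subset hy⟩) (hθs_min _ fun h => hne (congrArg Subtype.val h))
  obtain ⟨D, hDc, hD⟩ := TopologicalSpace.exists_countable_dense Θ
  have hrate : ∀ᵐ ω ∂μ, ∀ θ ∈ D, Tendsto (fun n : ℕ =>
      ENNReal.log (likelihood p (fun i => X i ω) (fun i => Y i ω) n θ) / n) atTop (𝓝 (ℓ θ)) :=
    (ae_ball_iff hDc).2 fun θ _ => by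
      simp only [ℓ, expectedLog_coe]
      exact ae_tendsto_log_prod_div hlaw hindep (hpm θ) (hfin θ)
  have hconcave : ∀ᵐ ω ∂μ, ∀ i, ConcaveLog Θ fun θ => p θ (X i ω) (Y i ω) :=
    ae_all_iff.2 fun i => ae_of_ae_map (hlaw i).aemeasurable ((hlaw i).map_eq.symm ▸ hconc)
  filter_upwards [hrate, hconcave] with ω hrateω hconcaveω U hU
  exact tendsto_bayesPosterior_of_logConcaveOn
    (fun n => LogConcaveOn.prod hℓ.1 fun i _ => (hconcaveω i).logConcaveOn)
    hℓ.continuousOn_interior hD (fun θ hθ => (hrateω θ hθ).liminf_eq.ge)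
    (fun θ hθ => (hrateω θ hθ).limsup_eq.le) hθs_int hmax hprior hU

theorem mainTheorem2 {q d : ℕ}
    -- covariate space, response space, parameter set
    (𝒳 : Set (EuclideanSpace ℝ (Fin q))) (𝒴 : Set ℝ) (Θ : Set (EuclideanSpace ℝ (Fin d)))
    -- the latent model `P_{Z | θ, X}`: continuous distributions on `ℝ`
    (PZ : Θ → Kernel 𝒳 ℝ) [∀ θ, IsMarkovKernel (PZ θ)] (hPZ : ∀ θ x z, PZ θ x {z} = 0)
    -- the fixed transformation and the induced conditional law `P_{Y | g, θ, X}`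
    (g : 𝒴 → ℝ) (hg : Monotone g)
    (Q : Θ → Kernel 𝒳 𝒴) [∀ θ, IsMarkovKernel (Q θ)] (hQ : ∀ θ, InducedBy g (PZ θ) (Q θ))
    -- the likelihood `p θ x y = p(y | g, θ, x)`
    (ν : Measure 𝒴) [SigmaFinite ν] (p : Θ → 𝒳 → 𝒴 → ℝ≥0)
    (hp_meas : Measurable fun t : Θ × 𝒳 × 𝒴 => p t.1 t.2.1 t.2.2)
    (hp : ∀ θ, IsCondDensity ν (Q θ) (p θ))
    -- the prior
    (prior : Measure Θ) [IsProbabilityMeasure prior]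
    -- the data: independent draws from an arbitrary data-generating process `P₀`
    (P₀ : Measure (𝒳 × 𝒴)) [IsProbabilityMeasure P₀]
    {Ω : Type*} [MeasurableSpace Ω] (μ : Measure Ω) [IsProbabilityMeasure μ]
    (X : ℕ → Ω → 𝒳) (Y : ℕ → Ω → 𝒴)
    (hlaw : ∀ i, HasLaw (fun ω => (X i ω, Y i ω)) P₀ μ)
    (hindep : iIndepFun (fun i ω => (X i ω, Y i ω)) μ)
    -- `θs` is the unique minimizer over `Θ` of the KL divergence and is interior
    (θs : Θ) (hθs_int : (θs : EuclideanSpace ℝ (Fin d)) ∈ interior Θ)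
    (hθs_min : ∀ θ : Θ, θ ≠ θs →
      InformationTheory.klDiv P₀ (P₀.fst ⊗ₘ Q θs) < InformationTheory.klDiv P₀ (P₀.fst ⊗ₘ Q θ))
    -- finite expected log-likelihood
    (hfin : ∀ θ, FiniteExpectedLog P₀ fun xy => p θ xy.1 xy.2)
    -- concave log-likelihood, almost surely
    (hconc : ∀ᵐ xy ∂P₀, ConcaveLog Θ fun θ => p θ xy.1 xy.2)
    -- the prior charges every neighbourhood of the minimizer
    (hprior : ∀ U : Set Θ, IsOpen U → θs ∈ U → 0 < prior U) :
    StronglyConsistentAt μ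
      (fun n ω => bayesPosterior prior (likelihood p (fun i => X i ω) (fun i => Y i ω) n)) θs :=
  mainTheorem2_general Θ Q ν p hp_meas hp prior P₀ μ X Y hlaw (fun _ _ h => hindep.indepFun h)
    θs hθs_int hθs_min hfin hconc
    ((Measure.support_eq_forall_isOpen (μ := prior)).symm ▸ fun U hθs hU => hprior U hU hθs)
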